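/- Let $a, q \in C^\infty(\mathbb{R})$ be real-valued with $a \ge 0$, $q \ge 0$, and write $\langle x\rangle := (1+x^2)^{1/2}$. Assume that (i) $a(x) \to +\infty$ as $|x| \to +\infty$; (ii) for every integer $n \ge 1$ there is $C_n > 0$ with $|a^{(n)}(x)| \le C_n (1 + a(x)) \langle x\rangle^{-n}$ for all $x \in \mathbb{R}$; (iii) for every integer $n \ge 1$ there is $C_n' > 0$ with $|q^{(n)}(x)| \le C_n' (1 + q(x)) \langle x\rangle^{-n}$ for all $x \in \mathbb{R}$; (iv) there are $x_0 > 0$ and $K > 0$ with $q(x) \le K a(x)$ for all $|x| > x_0$. Let $\mathcal{H}_1$ be the completion of $C_c^\infty(\mathbb{R})$ (complex-valued functions) with respect to the inner product $\langle f, g\rangle_{\mathcal{W}} := \int_{\mathbb{R}} f' \overline{g'} \, dx + \int_{\mathbb{R}} q f \overline{g} \, dx$, let $\mathcal{H}_2 := L^2(\mathbb{R})$ and $\mathcal{H} := \mathcal{H}_1 \oplus \mathcal{H}_2$. Let $\mathcal{D}_S := \{u \in W^{1,2}(\mathbb{R}) : q^{1/2}u \in L^2(\mathbb{R}),\ a^{1/2}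 u \in L^2(\mathbb{R})\}$ with inner product $\langle f,g\rangle_S := \int f'\overline{g'} + \int q f \overline g + \int a f \overline g + \int f \overline g$, and let $\mathcal{D}_S^*$ be the space of bounded conjugate-linear functionals on $\mathcal{D}_S$. Then $\mathcal{D}_S \subset \mathcal{H}_2 \subset \mathcal{D}_S^*$ canonically (the second inclusion being $h \mapsto (g \mapsto \int h \overline g)$), $\mathcal{D}_S$ is continuously embedded in $\mathcal{H}_1$ (extending the identity of $C_c^\infty(\mathbb{R})$), and $\partial_x^2 - q : \mathcal{H}_1 \to \mathcal{D}_S^*$ and $a : \mathcal{D}_S \to \mathcal{D}_S^*$ denote the unique bounded extensions of $((\partial_x^2 - q) f, g) := -\int (f' \overline{g'} + q f \overline g)$ and $(a f, g) := \int a f \overline g$, $f, g \in C_c^\infty(\mathbb{R})$. Let $G$ be the operator in $\mathcal{H}$ given by $$G \begin{pmatrix} u_1 \\ u_2 \end{pmatrix} := \begin{pmatrix} u_2 \\ (\partial_x^2 - q) u_1 - 2 a u_2 \end{pmatrix}, \qquad \operatorname{Dom}(G) := \{(u_1, u_2) \in \mathcal{H}_1 \oplus \mathcal{D}_S : (\partial_x^2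 - q) u_1 - 2 a u_2 \in \mathcal{H}_2\}.$$ If moreover $a \ne 0$ almost everywhere, then $G$ has no eigenvalue on the imaginary axis: $\sigma_p(G) \cap i\mathbb{R} = \emptyset$. -/

import Mathlib

open MeasureTheory Filter Topology
open scoped ContDiff ComplexConjugate InnerProductSpace

noncomputable section

namespace DampedWave

/-- The complex Hilbert space `L²(ℝ)`. -/
abbrev L2 : Type := Lp ℂ 2 (volume : Measure ℝ)

/-- `C_c^∞(ℝ)`: smooth compactly supported complex-valued functions. -/
def testFun : Submodule ℂ (ℝ → ℂ) where
  carrier := {f | ContDiff ℝ ∞ f ∧ HasCompactSupport f}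
  add_mem' hf hg := ⟨hf.1.add hg.1, hf.2.add hg.2⟩
  zero_mem' := ⟨contDiff_const, HasCompactSupport.zero⟩
  smul_mem' c _ hf := ⟨contDiff_const.smul hf.1, hf.2.smul_left (f := fun _ => c)⟩

theorem testFun.memLp (f : testFun) : MemLp (f : ℝ → ℂ) 2 volume :=
  f.2.1.continuous.memLp_of_hasCompactSupport f.2.2

theorem testFun.differentiable (f : testFun) : Differentiable ℝ (f : ℝ → ℂ) :=
  f.2.1.differentiable (by simp)

theorem testFun.continuous_deriv (f : testFun) : Continuous (deriv (f : ℝ → ℂ)) :=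
  f.2.1.continuous_deriv (by simp)

theorem testFun.memLp_deriv (f : testFun) : MemLp (deriv (f : ℝ → ℂ)) 2 volume :=
  (testFun.continuous_deriv f).memLp_of_hasCompactSupport f.2.2.deriv

/-- `v` is the weak derivative of `u`: `∫ u φ' = -∫ v φ` for all test functions `φ`. -/
def IsWeakDeriv (u v : L2) : Prop :=
  ∀ φ ∈ testFun, ∫ x, u x * deriv φ x = -∫ x, v x * φ x

theorem integrable_mul_of_memLp {f g : ℝ → ℂ} (hf : MemLp f 2 volume) (hg : MemLp g 2 volume) :
    Integrable (fun x => f x * g x) volume := hf.integrable_mul hg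

theorem isWeakDeriv_zero : IsWeakDeriv 0 0 := by
  intro φ _
  have h : ((0 : L2) : ℝ → ℂ) =ᵐ[volume] 0 := Lp.coeFn_zero _ _ _
  rw [integral_eq_zero_of_ae, integral_eq_zero_of_ae, neg_zero]
  · filter_upwards [h] with x hx; rw [hx]; simp
  · filter_upwards [h] with x hx; rw [hx]; simp

theorem IsWeakDeriv.add {u v u' v' : L2} (h : IsWeakDeriv u v) (h' : IsWeakDeriv u' v') :
    IsWeakDeriv (u + u') (v + v') := by
  intro φ hφ
  have e1 : ∫ x, (u + u' : L2) x * deriv φ x = ∫ x, (u x * deriv φ x + u' x * deriv φ x) := by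
    refine integral_congr_ae ?_
    filter_upwards [Lp.coeFn_add u u'] with x hx
    rw [hx, Pi.add_apply, add_mul]
  have e2 : ∫ x, (v + v' : L2) x * φ x = ∫ x, (v x * φ x + v' x * φ x) := by
    refine integral_congr_ae ?_
    filter_upwards [Lp.coeFn_add v v'] with x hx
    rw [hx, Pi.add_apply, add_mul]
  have m1 := testFun.memLp ⟨φ, hφ⟩
  have m2 := testFun.memLp_deriv ⟨φ, hφ⟩
  rw [e1, e2, integral_add (integrable_mul_of_memLp (Lp.memLp u) m2)
    (integrable_mul_of_memLp (Lp.memLp u') m2), integral_add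
    (integrable_mul_of_memLp (Lp.memLp v) m1) (integrable_mul_of_memLp (Lp.memLp v') m1),
    h φ hφ, h' φ hφ]
  ring

theorem IsWeakDeriv.smul {u v : L2} (c : ℂ) (h : IsWeakDeriv u v) :
    IsWeakDeriv (c • u) (c • v) := by
  intro φ hφ
  have e1 : ∫ x, (c • u : L2) x * deriv φ x = ∫ x, c * (u x * deriv φ x) := by
    refine integral_congr_ae ?_
    filter_upwards [Lp.coeFn_smul c u] with x hx
    simp [hx, mul_assoc]
  have e2 : ∫ x, (c • v : L2) x * φ x = ∫ x, c * (v x * φ x) := by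
    refine integral_congr_ae ?_
    filter_upwards [Lp.coeFn_smul c v] with x hx
    simp [hx, mul_assoc]
  rw [e1, e2, integral_const_mul, integral_const_mul, h φ hφ]
  ring

/-- An `L²` function annihilating all test functions vanishes. -/
theorem eq_zero_of_integral_test {v : L2} (h : ∀ φ ∈ testFun, ∫ x, v x * φ x = 0) : v = 0 := by
  rw [Lp.eq_zero_iff_ae_eq_zero]
  refine ae_eq_zero_of_integral_contDiff_smul_eq_zero
    ((Lp.memLp v).locallyIntegrable (by norm_num)) ?_
  intro g hg hgc
  have := h (fun x => (g x : ℂ)) ⟨Complex.ofRealCLM.contDiff.comp hg,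
    hgc.comp_left (g := fun t : ℝ => (t : ℂ)) (by simp)⟩
  rw [← this]
  refine integral_congr_ae (Eventually.of_forall fun x => ?_)
  simp [mul_comm]

theorem IsWeakDeriv.unique {u v v' : L2} (h : IsWeakDeriv u v) (h' : IsWeakDeriv u v') :
    v = v' := by
  have h0 : IsWeakDeriv (u + (-1 : ℂ) • u) (v + (-1 : ℂ) • v') := h.add (h'.smul (-1))
  have hu : u + (-1 : ℂ) • u = 0 := by simp
  rw [hu] at h0
  have : v + (-1 : ℂ) • v' = 0 := by
    refine eq_zero_of_integral_test fun φ hφ => ?_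
    have h1 := h0 φ hφ
    rw [integral_eq_zero_of_ae] at h1
    · simpa using h1.symm
    · filter_upwards [Lp.coeFn_zero ℂ 2 (volume : Measure ℝ)] with x hx
      rw [hx]; simp
  simpa [← sub_eq_add_neg, sub_eq_zero] using this

/-- The Sobolev space `W^{1,2}(ℝ)`. -/
def W12 : Submodule ℂ L2 where
  carrier := {u | ∃ v, IsWeakDeriv u v}
  add_mem' := fun ⟨_, h⟩ ⟨_, h'⟩ => ⟨_, h.add h'⟩
  zero_mem' := ⟨0, isWeakDeriv_zero⟩
  smul_mem' := fun c _ ⟨_, h⟩ => ⟨_, h.smul c⟩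

/-- `∂ₓ : W^{1,2}(ℝ) → L²(ℝ)`, the weak derivative. -/
def weakDeriv : W12 →ₗ[ℂ] L2 where
  toFun u := u.2.choose
  map_add' u u' := (u + u').2.choose_spec.unique (u.2.choose_spec.add u'.2.choose_spec)
  map_smul' c u := (c • u).2.choose_spec.unique (u.2.choose_spec.smul c)

theorem weakDeriv_spec (u : W12) : IsWeakDeriv (u : L2) (weakDeriv u) := u.2.choose_spec

/-- `Dom(m) = {u ∈ L² : m u ∈ L²}`. -/
def mulDom (m : ℝ → ℝ) : Submodule ℂ L2 where
  carrier := {u | MemLp (fun x => (m x : ℂ) * u x) 2 volume}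
  add_mem' {u u'} h h' := by
    refine (MemLp.add h h').ae_eq ?_
    filter_upwards [Lp.coeFn_add u u'] with x hx
    rw [hx]; simp [mul_add]
  zero_mem' := by
    refine (MemLp.zero (ε := ℂ)).ae_eq ?_
    filter_upwards [Lp.coeFn_zero ℂ 2 (volume : Measure ℝ)] with x hx
    rw [hx]; simp
  smul_mem' c u h := by
    refine (MemLp.const_mul h c).ae_eq ?_
    filter_upwards [Lp.coeFn_smul c u] with x hx
    simp only [hx, Pi.smul_apply, smul_eq_mul]
    ring

/-- Multiplication by `m`, on its maximal domain. -/
def mulOp (m : ℝ → ℝ) : mulDom m →ₗ[ℂ] L2 where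
  toFun u := MemLp.toLp (fun x => (m x : ℂ) * (u : L2) x) u.2
  map_add' u u' := by
    apply Lp.ext
    filter_upwards [MemLp.coeFn_toLp (u + u').2, MemLp.coeFn_toLp u.2, MemLp.coeFn_toLp u'.2,
      Lp.coeFn_add (u : L2) u', Lp.coeFn_add (MemLp.toLp _ u.2) (MemLp.toLp _ u'.2)]
      with x h1 h2 h3 h4 h5
    rw [h1, h5, Pi.add_apply, h2, h3, Submodule.coe_add, h4, Pi.add_apply, mul_add]
  map_smul' c u := by
    apply Lp.ext
    filter_upwards [MemLp.coeFn_toLp (c • u).2, MemLp.coeFn_toLp u.2,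
      Lp.coeFn_smul c (u : L2), Lp.coeFn_smul c (MemLp.toLp _ u.2)] with x h1 h2 h4 h5
    rw [h1]
    simp only [RingHom.id_apply]
    rw [h5, Pi.smul_apply, h2]
    simp only [Submodule.coe_smul, h4, Pi.smul_apply, smul_eq_mul]
    ring

theorem coeFn_mulOp (m : ℝ → ℝ) (u : mulDom m) :
    (mulOp m u : ℝ → ℂ) =ᵐ[volume] fun x => (m x : ℂ) * (u : L2) x := MemLp.coeFn_toLp u.2

theorem integral_mul_conj_eq_inner (u v : L2) : ∫ x, u x * conj (v x) = ⟪v, u⟫_ℂ := by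
  rw [L2.inner_def]
  rfl

/-- For `m ≥ 0`, the form `∫ m u v̄` is the `L²` inner product of `√m u` and `√m v`. -/
theorem integral_weight_eq_inner {m : ℝ → ℝ} (hm : ∀ᵐ x, 0 ≤ m x)
    (u v : mulDom (fun x => √(m x))) :
    ∫ x, (m x : ℂ) * (u : L2) x * conj ((v : L2) x) =
      ⟪mulOp (fun x => √(m x)) v, mulOp (fun x => √(m x)) u⟫_ℂ := by
  rw [← integral_mul_conj_eq_inner]
  refine integral_congr_ae ?_
  filter_upwards [hm, coeFn_mulOp _ u, coeFn_mulOp _ v] with x h0 h1 h2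
  rw [h1, h2]
  have : ((√(m x) : ℝ) : ℂ) * (√(m x) : ℝ) = (m x : ℂ) := by
    rw [← Complex.ofReal_mul, Real.mul_self_sqrt h0]
  simp only [map_mul, Complex.conj_ofReal]
  rw [← this]
  ring

/-- Coefficients of the damped wave equation `∂ₜ²u + 2a ∂ₜu = (∂ₓ² - q)u`: the damping `a` and the
potential `q` are locally integrable and nonnegative almost everywhere. -/
structure Coeff where
  a : ℝ → ℝ
  q : ℝ → ℝ
  a_loc : LocallyIntegrable a volume
  q_loc : LocallyIntegrable q volume
  a_nonneg : ∀ᵐ x, 0 ≤ a x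
  q_nonneg : ∀ᵐ x, 0 ≤ q x

namespace Coeff

variable (D : Coeff)

/-! ### The form domain `D_S` -/

/-- `W^{1,2}(ℝ) ∩ Dom(q^{1/2}) ∩ Dom(a^{1/2})` as a subspace of `L²(ℝ)`. -/
def formDom : Submodule ℂ L2 :=
  W12 ⊓ mulDom (fun x => √(D.q x)) ⊓ mulDom (fun x => √(D.a x))

/-- The space `D_S`, as a type of its own, to carry the inner product `⟨·,·⟩_S` rather than
that of `L²(ℝ)`. -/
def DS : Type := D.formDom

instance : AddCommGroup D.DS := inferInstanceAs (AddCommGroup D.formDom)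
instance : Module ℂ D.DS := inferInstanceAs (Module ℂ D.formDom)

namespace DS

variable {D}

/-- The inclusion `D_S ⊂ L²(ℝ)`. -/
def toL2 : D.DS →ₗ[ℂ] L2 := D.formDom.subtype

theorem toL2_injective : Function.Injective (toL2 : D.DS →ₗ[ℂ] L2) :=
  Submodule.subtype_injective _

/-- The weak derivative on `D_S`. -/
def dx : D.DS →ₗ[ℂ] L2 :=
  weakDeriv ∘ₗ Submodule.inclusion (p := D.formDom) (inf_le_left.trans inf_le_left)

theorem dx_spec (u : D.DS) : IsWeakDeriv (toL2 u) (dx u) :=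
  weakDeriv_spec (Submodule.inclusion (p := D.formDom) (inf_le_left.trans inf_le_left) u)

/-- `u ↦ q^{1/2} u` on `D_S`. -/
def sqrtQ : D.DS →ₗ[ℂ] L2 :=
  mulOp (fun x => √(D.q x)) ∘ₗ
    Submodule.inclusion (p := D.formDom) (inf_le_left.trans inf_le_right)

/-- `u ↦ a^{1/2} u` on `D_S`. -/
def sqrtA : D.DS →ₗ[ℂ] L2 :=
  mulOp (fun x => √(D.a x)) ∘ₗ Submodule.inclusion (p := D.formDom) inf_le_right

theorem integral_q (u v : D.DS) :
    ∫ x, (D.q x : ℂ) * toL2 u x * conj (toL2 v x) = ⟪sqrtQ v, sqrtQ u⟫_ℂ :=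
  integral_weight_eq_inner D.q_nonneg (Submodule.inclusion _ u) (Submodule.inclusion _ v)

theorem integral_a (u v : D.DS) :
    ∫ x, (D.a x : ℂ) * toL2 u x * conj (toL2 v x) = ⟪sqrtA v, sqrtA u⟫_ℂ :=
  integral_weight_eq_inner D.a_nonneg (Submodule.inclusion _ u) (Submodule.inclusion _ v)

/-- The inner product `⟨f, g⟩_S`, linear in `f` and conjugate-linear in `g`. -/
def innerS (f g : D.DS) : ℂ :=
  (∫ x, dx f x * conj (dx g x)) + (∫ x, (D.q x : ℂ) * toL2 f x * conj (toL2 g x)) +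
    (∫ x, (D.a x : ℂ) * toL2 f x * conj (toL2 g x)) + ∫ x, toL2 f x * conj (toL2 g x)

theorem innerS_eq (f g : D.DS) : innerS f g =
    ⟪dx g, dx f⟫_ℂ + ⟪sqrtQ g, sqrtQ f⟫_ℂ + ⟪sqrtA g, sqrtA f⟫_ℂ + ⟪toL2 g, toL2 f⟫_ℂ := by
  rw [innerS, integral_q, integral_a, integral_mul_conj_eq_inner, integral_mul_conj_eq_inner]

/-- Mathlib's inner products are conjugate-linear in the first argument, hence the swap. -/
@[reducible] def core : InnerProductSpace.Core ℂ D.DS where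
  inner f g := innerS g f
  conj_inner_symm f g := by simp only [innerS_eq, map_add, inner_conj_symm]
  re_inner_nonneg f := by
    have h (w : L2) : 0 ≤ RCLike.re ⟪w, w⟫_ℂ := inner_self_nonneg
    simp only [innerS_eq, map_add]
    have h1 := h (dx f)
    have h2 := h (sqrtQ f)
    have h3 := h (sqrtA f)
    have h4 := h (toL2 f)
    linarith
  add_left f g h := by simp only [innerS_eq, map_add, inner_add_left]; ring
  smul_left f g c := by simp only [innerS_eq, map_smul, inner_smul_left]; ring
  definite f hf := by
    have h (w : L2) : 0 ≤ RCLike.re ⟪w, w⟫_ℂ := inner_self_nonneg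
    simp only [innerS_eq] at hf
    have hre := congrArg RCLike.re hf
    simp only [map_add, map_zero] at hre
    have h1 := h (dx f)
    have h2 := h (sqrtQ f)
    have h3 := h (sqrtA f)
    have h4 := h (toL2 f)
    have h5 : RCLike.re ⟪toL2 f, toL2 f⟫_ℂ = 0 := by linarith
    rw [inner_self_eq_norm_sq (𝕜 := ℂ)] at h5
    have h6 : toL2 f = 0 := by simpa using h5
    exact toL2_injective (by rw [h6, map_zero])

instance : NormedAddCommGroup D.DS := core.toNormedAddCommGroup
instance : InnerProductSpace ℂ D.DS := InnerProductSpace.ofCore core.toCore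

theorem inner_eq (f g : D.DS) : ⟪f, g⟫_ℂ = innerS g f := rfl

theorem norm_sq (f : D.DS) :
    ‖f‖ ^ 2 = ‖dx f‖ ^ 2 + ‖sqrtQ f‖ ^ 2 + ‖sqrtA f‖ ^ 2 + ‖toL2 f‖ ^ 2 := by
  rw [← inner_self_eq_norm_sq (𝕜 := ℂ), inner_eq, innerS_eq]
  simp only [map_add]
  rw [inner_self_eq_norm_sq (𝕜 := ℂ), inner_self_eq_norm_sq (𝕜 := ℂ),
    inner_self_eq_norm_sq (𝕜 := ℂ), inner_self_eq_norm_sq (𝕜 := ℂ)]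

end DS

/-- `D_S^*`: the bounded conjugate-linear functionals on `D_S`. -/
abbrev DSDual : Type := D.DS →L⋆[ℂ] ℂ

/-! ### The energy space `W(ℝ)` -/

/-- `C_c^∞(ℝ)`, to be equipped with the inner product `⟨·,·⟩_W`. -/
def Test (_D : Coeff) : Type := testFun

instance : AddCommGroup D.Test := inferInstanceAs (AddCommGroup testFun)
instance : Module ℂ D.Test := inferInstanceAs (Module ℂ testFun)

theorem memLp_sqrt_mul {m : ℝ → ℝ} (hm : LocallyIntegrable m volume) (hm0 : ∀ᵐ x, 0 ≤ m x)
    (f : testFun) : MemLp (fun x => ((√(m x) : ℝ) : ℂ) * (f : ℝ → ℂ) x) 2 volume := by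
  have hmeas : AEStronglyMeasurable (fun x => ((√(m x) : ℝ) : ℂ) * (f : ℝ → ℂ) x) volume :=
    (Complex.continuous_ofReal.comp_aestronglyMeasurable
      (Real.continuous_sqrt.comp_aestronglyMeasurable hm.aestronglyMeasurable)).mul
      f.2.1.continuous.aestronglyMeasurable
  rw [memLp_two_iff_integrable_sq_norm hmeas]
  have hc : Continuous fun x => ‖(f : ℝ → ℂ) x‖ ^ 2 := f.2.1.continuous.norm.pow 2
  have hs : HasCompactSupport fun x => ‖(f : ℝ → ℂ) x‖ ^ 2 :=
    f.2.2.comp_left (g := fun z : ℂ => ‖z‖ ^ 2) (by simp)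
  refine (hm.integrable_smul_left_of_hasCompactSupport hc hs).congr ?_
  filter_upwards [hm0] with x hx
  rw [norm_mul, mul_pow, Complex.norm_real, Real.norm_eq_abs, sq_abs, Real.sq_sqrt hx,
    smul_eq_mul, mul_comm]

theorem isWeakDeriv_test (f : testFun) :
    IsWeakDeriv ((testFun.memLp f).toLp _) ((testFun.memLp_deriv f).toLp _) := by
  intro φ hφ
  have e1 : ∫ x, ((testFun.memLp f).toLp _ : L2) x * deriv φ x = ∫ x, (f : ℝ → ℂ) x * deriv φ x :=
    integral_congr_ae (by
      filter_upwards [(testFun.memLp f).coeFn_toLp] with x hx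
      rw [hx])
  have e2 : ∫ x, ((testFun.memLp_deriv f).toLp _ : L2) x * φ x = ∫ x, deriv (f : ℝ → ℂ) x * φ x :=
    integral_congr_ae (by
      filter_upwards [(testFun.memLp_deriv f).coeFn_toLp] with x hx
      rw [hx])
  have m1 := testFun.memLp ⟨φ, hφ⟩
  have m2 := testFun.memLp_deriv ⟨φ, hφ⟩
  rw [e1, e2]
  exact integral_mul_deriv_eq_deriv_mul_of_integrable
    (fun x _ => ((testFun.differentiable f) x).hasDerivAt)
    (fun x _ => (testFun.differentiable ⟨φ, hφ⟩ x).hasDerivAt)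
    (integrable_mul_of_memLp (testFun.memLp f) m2) (integrable_mul_of_memLp (testFun.memLp_deriv f) m1)
    (integrable_mul_of_memLp (testFun.memLp f) m1)

theorem test_mem_formDom (f : testFun) : ((testFun.memLp f).toLp _ : L2) ∈ D.formDom := by
  have h {m : ℝ → ℝ} (hm : LocallyIntegrable m volume) (hm0 : ∀ᵐ x, 0 ≤ m x) :
      ((testFun.memLp f).toLp _ : L2) ∈ mulDom (fun x => √(m x)) := by
    refine (memLp_sqrt_mul hm hm0 f).ae_eq ?_
    filter_upwards [(testFun.memLp f).coeFn_toLp] with x hx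
    rw [hx]
  exact ⟨⟨⟨_, isWeakDeriv_test f⟩, h D.q_loc D.q_nonneg⟩, h D.a_loc D.a_nonneg⟩

namespace Test

variable {D}

/-- A test function as a function. -/
def fn (f : D.Test) : ℝ → ℂ := f.1

/-- The inner product `⟨f, g⟩_W = ∫ f' ḡ' + ∫ q f ḡ`. -/
def innerW (f g : D.Test) : ℂ :=
  (∫ x, deriv f.fn x * conj (deriv g.fn x)) + ∫ x, (D.q x : ℂ) * f.fn x * conj (g.fn x)

/-- The inclusion `C_c^∞(ℝ) ⊂ D_S`. -/
def toDS : D.Test →ₗ[ℂ] D.DS where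
  toFun f := ⟨(testFun.memLp f).toLp _, D.test_mem_formDom f⟩
  map_add' _ _ := rfl
  map_smul' _ _ := rfl

theorem coeFn_toDS (f : D.Test) : (DS.toL2 (toDS f) : ℝ → ℂ) =ᵐ[volume] f.fn :=
  (testFun.memLp f).coeFn_toLp

theorem coeFn_dx_toDS (f : D.Test) : (DS.dx (toDS f) : ℝ → ℂ) =ᵐ[volume] deriv f.fn := by
  have h : DS.dx (toDS f) = (testFun.memLp_deriv f).toLp _ :=
    (DS.dx_spec (toDS f)).unique (isWeakDeriv_test f)
  rw [h]
  exact (testFun.memLp_deriv f).coeFn_toLp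

theorem innerW_eq (f g : D.Test) : innerW f g =
    ⟪DS.dx (toDS g), DS.dx (toDS f)⟫_ℂ + ⟪DS.sqrtQ (toDS g), DS.sqrtQ (toDS f)⟫_ℂ := by
  rw [innerW, ← DS.integral_q, ← integral_mul_conj_eq_inner]
  congr 1
  · refine integral_congr_ae ?_
    filter_upwards [coeFn_dx_toDS f, coeFn_dx_toDS g] with x h1 h2
    rw [h1, h2]
  · refine integral_congr_ae ?_
    filter_upwards [coeFn_toDS f, coeFn_toDS g] with x h1 h2
    rw [h1, h2]

@[reducible] def core : PreInnerProductSpace.Core ℂ D.Test where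
  inner f g := innerW g f
  conj_inner_symm f g := by simp only [innerW_eq, map_add, inner_conj_symm]
  re_inner_nonneg f := by
    have h (w : L2) : 0 ≤ RCLike.re ⟪w, w⟫_ℂ := inner_self_nonneg
    simp only [innerW_eq, map_add]
    exact add_nonneg (h _) (h _)
  add_left f g h := by simp only [innerW_eq, map_add, inner_add_left]; ring
  smul_left f g c := by simp only [innerW_eq, map_smul, inner_smul_left]; ring

instance : SeminormedAddCommGroup D.Test :=
  InnerProductSpace.Core.toSeminormedAddCommGroup (c := core)
instance : InnerProductSpace ℂ D.Test := InnerProductSpace.ofCore core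

theorem inner_eq (f g : D.Test) : ⟪f, g⟫_ℂ = innerW g f := rfl

theorem norm_sq (f : D.Test) :
    ‖f‖ ^ 2 = ‖DS.dx (toDS f)‖ ^ 2 + ‖DS.sqrtQ (toDS f)‖ ^ 2 := by
  rw [← inner_self_eq_norm_sq (𝕜 := ℂ), inner_eq, innerW_eq, map_add,
    inner_self_eq_norm_sq (𝕜 := ℂ), inner_self_eq_norm_sq (𝕜 := ℂ)]

end Test

/-- `H₁ = W(ℝ)`: the completion of `C_c^∞(ℝ)` with respect to `⟨·,·⟩_W`. -/
abbrev H1 : Type := UniformSpace.Completion D.Test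

/-! ### The entries of the operator matrix -/

/-- `((∂ₓ² - q) f, g) = -∫ (f' ḡ' + q f ḡ)`, for `f ∈ C_c^∞(ℝ)` and `g ∈ D_S`. -/
def lapForm (f : D.Test) (g : D.DS) : ℂ :=
  -((∫ x, deriv f.fn x * conj (DS.dx g x)) +
    ∫ x, (D.q x : ℂ) * f.fn x * conj (DS.toL2 g x))

theorem lapForm_eq (f : D.Test) (g : D.DS) : D.lapForm f g =
    -(⟪DS.dx g, DS.dx (Test.toDS f)⟫_ℂ + ⟪DS.sqrtQ g, DS.sqrtQ (Test.toDS f)⟫_ℂ) := by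
  rw [lapForm, ← DS.integral_q, ← integral_mul_conj_eq_inner]
  congr 2
  · refine integral_congr_ae ?_
    filter_upwards [Test.coeFn_dx_toDS f] with x h1
    rw [h1]
  · refine integral_congr_ae ?_
    filter_upwards [Test.coeFn_toDS f] with x h1
    rw [h1]

theorem norm_lapForm_le (f : D.Test) (g : D.DS) : ‖D.lapForm f g‖ ≤ 1 * ‖f‖ * ‖g‖ := by
  rw [lapForm_eq, norm_neg, one_mul]
  set s := DS.dx g
  set t := DS.sqrtQ g
  set s' := DS.dx (Test.toDS f)
  set t' := DS.sqrtQ (Test.toDS f)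
  have h1 : ‖⟪s, s'⟫_ℂ + ⟪t, t'⟫_ℂ‖ ≤ ‖s‖ * ‖s'‖ + ‖t‖ * ‖t'‖ :=
    (norm_add_le _ _).trans (add_le_add (norm_inner_le_norm _ _) (norm_inner_le_norm _ _))
  refine h1.trans (le_of_sq_le_sq ?_ (by positivity))
  rw [mul_pow, Test.norm_sq, DS.norm_sq]
  change (‖s‖ * ‖s'‖ + ‖t‖ * ‖t'‖) ^ 2 ≤
    (‖s'‖ ^ 2 + ‖t'‖ ^ 2) * (‖s‖ ^ 2 + ‖t‖ ^ 2 + ‖DS.sqrtA g‖ ^ 2 + ‖DS.toL2 g‖ ^ 2)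
  have h2 : 0 ≤ (‖s'‖ ^ 2 + ‖t'‖ ^ 2) * (‖DS.sqrtA g‖ ^ 2 + ‖DS.toL2 g‖ ^ 2) := by positivity
  nlinarith [sq_nonneg (‖s‖ * ‖t'‖ - ‖t‖ * ‖s'‖)]

/-- `∂ₓ² - q` on `C_c^∞(ℝ)`, as a bounded operator into `D_S^*`. -/
def lapTest : D.Test →L[ℂ] D.DSDual :=
  LinearMap.mkContinuous₂ (LinearMap.mk₂'ₛₗ (RingHom.id ℂ) (starRingEnd ℂ) D.lapForm
    (fun f f' g => by simp only [lapForm_eq, map_add, inner_add_right]; ring)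
    (fun c f g => by
      simp only [lapForm_eq, map_smul, inner_smul_right, RingHom.id_apply, smul_eq_mul]; ring)
    (fun f g g' => by simp only [lapForm_eq, map_add, inner_add_left]; ring)
    (fun c f g => by simp only [lapForm_eq, map_smul, inner_smul_left, smul_eq_mul]; ring))
    1 D.norm_lapForm_le

/-- `∂ₓ² - q ∈ L(H₁, D_S^*)`: the unique bounded extension from `C_c^∞(ℝ)` to its
completion. -/
def lap : D.H1 →L[ℂ] D.DSDual :=
  D.lapTest.extend UniformSpace.Completion.toComplL

theorem lap_coe (f : D.Test) (g : D.DS) : D.lap (f : D.H1) g = D.lapForm f g := by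
  have h : D.lap (UniformSpace.Completion.toComplL (𝕜 := ℂ) f) = D.lapTest f :=
    ContinuousLinearMap.extend_eq _ UniformSpace.Completion.denseRange_coe
      (UniformSpace.Completion.isUniformInducing_coe _) f
  exact congrArg (fun T : D.DSDual => T g) h

/-- The canonical embedding `D_S → H₁`. The element `g ∈ D_S` is sent to the element `w` of the
completion `H₁` that has the same energy products with all test functions,
`⟨f, w⟩_W = ∫ (f' ḡ' + q f ḡ)` (it exists and is unique, as the right-hand side is bounded in
`f` for `‖f‖_W`). This map is bounded and, on `C_c^∞(ℝ)`, it is the inclusion into the completion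
(`embed_toDS`); as `C_c^∞(ℝ)` is dense in `D_S`, it is the continuous extension of that
inclusion. -/
def embed : D.DS →L[ℂ] D.H1 :=
  ((InnerProductSpace.toDual ℂ D.H1).symm.toContinuousLinearEquiv :
    (StrongDual ℂ D.H1) →L⋆[ℂ] D.H1).comp (-D.lap).flip

theorem inner_embed (g : D.DS) (w : D.H1) : ⟪D.embed g, w⟫_ℂ = -D.lap w g := by
  change ⟪(InnerProductSpace.toDual ℂ D.H1).symm ((-D.lap).flip g), w⟫_ℂ = _
  rw [InnerProductSpace.toDual_symm_apply]
  rfl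

theorem embed_toDS (f : D.Test) : D.embed (Test.toDS f) = (f : D.H1) := by
  refine ext_inner_right ℂ fun w => ?_
  rw [inner_embed]
  induction w using UniformSpace.Completion.induction_on with
  | hp =>
    refine isClosed_eq ?_ (by fun_prop)
    have := ((-D.lap).flip (Test.toDS f)).continuous
    exact this
  | ih g =>
    rw [lap_coe, lapForm_eq, UniformSpace.Completion.inner_coe, Test.inner_eq, Test.innerW_eq,
      neg_neg]

/-- `(a f, g) = ∫ a f ḡ`, for `f, g ∈ D_S`. -/
def dampForm (f g : D.DS) : ℂ := ∫ x, (D.a x : ℂ) * DS.toL2 f x * conj (DS.toL2 g x)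

theorem norm_dampForm_le (f g : D.DS) : ‖D.dampForm f g‖ ≤ 1 * ‖f‖ * ‖g‖ := by
  have h (u : D.DS) : ‖DS.sqrtA u‖ ≤ ‖u‖ := by
    refine le_of_sq_le_sq ?_ (norm_nonneg _)
    rw [DS.norm_sq u]
    nlinarith [sq_nonneg ‖DS.dx u‖, sq_nonneg ‖DS.sqrtQ u‖, sq_nonneg ‖DS.toL2 u‖]
  rw [dampForm, DS.integral_a, one_mul, mul_comm]
  exact (norm_inner_le_norm _ _).trans (mul_le_mul (h g) (h f) (norm_nonneg _) (norm_nonneg _))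

theorem dampForm_eq (f g : D.DS) : D.dampForm f g = ⟪DS.sqrtA g, DS.sqrtA f⟫_ℂ :=
  DS.integral_a f g

/-- Multiplication by `a`, as an operator in `L(D_S, D_S^*)`. -/
def damp : D.DS →L[ℂ] D.DSDual :=
  LinearMap.mkContinuous₂ (LinearMap.mk₂'ₛₗ (RingHom.id ℂ) (starRingEnd ℂ) D.dampForm
    (fun f f' g => by simp only [dampForm_eq, map_add, inner_add_right])
    (fun c f g => by
      simp only [dampForm_eq, map_smul, inner_smul_right, RingHom.id_apply,
        smul_eq_mul])
    (fun f g g' => by simp only [dampForm_eq, map_add, inner_add_left])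
    (fun c f g => by
      simp only [dampForm_eq, map_smul, inner_smul_left, smul_eq_mul]))
    1 D.norm_dampForm_le

/-- `(h, g) = ∫ h ḡ`, for `h ∈ L²(ℝ)` and `g ∈ D_S`. -/
def pairForm (h : L2) (g : D.DS) : ℂ := ∫ x, h x * conj (DS.toL2 g x)

theorem norm_pairForm_le (h : L2) (g : D.DS) : ‖D.pairForm h g‖ ≤ 1 * ‖h‖ * ‖g‖ := by
  have hg : ‖DS.toL2 g‖ ≤ ‖g‖ := by
    refine le_of_sq_le_sq ?_ (norm_nonneg _)
    rw [DS.norm_sq g]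
    nlinarith [sq_nonneg ‖DS.dx g‖, sq_nonneg ‖DS.sqrtQ g‖, sq_nonneg ‖DS.sqrtA g‖]
  rw [pairForm, integral_mul_conj_eq_inner, one_mul, mul_comm]
  exact (norm_inner_le_norm _ _).trans (mul_le_mul_of_nonneg_right hg (norm_nonneg _))

/-- The canonical embedding `H₂ = L²(ℝ) ⊂ D_S^*`. -/
def ofL2 : L2 →L[ℂ] D.DSDual :=
  LinearMap.mkContinuous₂ (LinearMap.mk₂'ₛₗ (RingHom.id ℂ) (starRingEnd ℂ) D.pairForm
    (fun f f' g => by simp only [pairForm, integral_mul_conj_eq_inner, inner_add_right])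
    (fun c f g => by
      simp only [pairForm, integral_mul_conj_eq_inner, inner_smul_right, RingHom.id_apply,
        smul_eq_mul])
    (fun f g g' => by simp only [pairForm, integral_mul_conj_eq_inner, map_add, inner_add_left])
    (fun c f g => by
      simp only [pairForm, integral_mul_conj_eq_inner, map_smul, inner_smul_left, smul_eq_mul]))
    1 D.norm_pairForm_le

theorem ofL2_injective : Function.Injective D.ofL2 := by
  rw [injective_iff_map_eq_zero]
  intro h hh
  refine eq_zero_of_integral_test fun φ hφ => ?_
  have hψ : (fun x => conj (φ x)) ∈ testFun :=
    ⟨Complex.conjCLE.contDiff.comp hφ.1, hφ.2.comp_left (g := fun z : ℂ => conj z) (by simp)⟩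
  let ψ : D.Test := ⟨_, hψ⟩
  have h1 : D.pairForm h (Test.toDS ψ) = 0 := congrArg (fun T : D.DSDual => T (Test.toDS ψ)) hh
  rw [← h1]
  refine integral_congr_ae ?_
  filter_upwards [Test.coeFn_toDS ψ] with x hx
  rw [hx]
  change _ = h x * conj (conj (φ x))
  rw [Complex.conj_conj]

/-! ### The operator `G` -/

/-- The operator matrix `Ĝ = (0, I; ∂ₓ² - q, -2a)`, from `H₁ ⊕ D_S` to `H₁ ⊕ D_S^*`. -/
def Ghat : D.H1 × D.DS →L[ℂ] D.H1 × D.DSDual :=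
  (D.embed.comp (ContinuousLinearMap.snd ℂ D.H1 D.DS)).prod
    (D.lap.comp (ContinuousLinearMap.fst ℂ D.H1 D.DS) -
      (2 : ℂ) • D.damp.comp (ContinuousLinearMap.snd ℂ D.H1 D.DS))

/-- The Hilbert space `H = H₁ ⊕ H₂`. -/
abbrev H : Type := WithLp 2 (D.H1 × L2)

/-- The graph of `G`: pairs `(u, v) ∈ H × H` with `u = (u₁, u₂) ∈ H₁ ⊕ D_S` and `Ĝ u = v`, the
latter as elements of `H₁ ⊕ D_S^*`. -/
def graphG : Submodule ℂ (D.H × D.H) where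
  carrier := {p | ∃ u₂ : D.DS, DS.toL2 u₂ = p.1.snd ∧
    D.Ghat (p.1.fst, u₂) = (p.2.fst, D.ofL2 p.2.snd)}
  add_mem' := by
    rintro p p' ⟨u, h1, h2⟩ ⟨u', h1', h2'⟩
    refine ⟨u + u', by simp [h1, h1'], ?_⟩
    have : ((p + p').1.fst, u + u') = (p.1.fst, u) + (p'.1.fst, u') := rfl
    rw [this, map_add, h2, h2']
    simp
  zero_mem' := by
    refine ⟨0, by simp, ?_⟩
    have : (((0 : D.H × D.H).1.fst, 0) : D.H1 × D.DS) = 0 := rfl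
    rw [this, map_zero]
    simp only [Prod.snd_zero, WithLp.zero_fst, WithLp.zero_snd, map_zero]
    rfl
  smul_mem' := by
    rintro c p ⟨u, h1, h2⟩
    refine ⟨c • u, by simp [h1], ?_⟩
    have : ((c • p).1.fst, c • u) = c • (p.1.fst, u) := rfl
    rw [this, map_smul, h2]
    simp

theorem graphG_isGraph (p : D.H × D.H) (hp : p ∈ D.graphG) (h0 : p.1 = 0) : p.2 = 0 := by
  obtain ⟨u, h1, h2⟩ := hp
  have hu : u = 0 := DS.toL2_injective (by rw [h1, h0, map_zero]; rfl)
  have : (p.1.fst, u) = (0 : D.H1 × D.DS) := by rw [h0, hu]; rfl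
  rw [this, map_zero] at h2
  have h3 : p.2.fst = 0 := (congrArg Prod.fst h2).symm
  have h4 : p.2.snd = 0 := D.ofL2_injective (by rw [map_zero]; exact (congrArg Prod.snd h2).symm)
  exact (WithLp.ofLp_injective 2) (Prod.ext h3 h4)

/-- The generator `G` in `H`: the restriction of `Ĝ` to
`Dom(G) = {u ∈ H₁ ⊕ D_S : Ĝ u ∈ H₁ ⊕ H₂}`. -/
def G : D.H →ₗ.[ℂ] D.H := D.graphG.toLinearPMap

theorem graph_G : D.G.graph = D.graphG :=
  D.graphG.toLinearPMap_graph_eq D.graphG_isGraph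

/-- `Dom(G)` consists of the `(u₁, u₂) ∈ H₁ ⊕ D_S` with `(∂ₓ² - q)u₁ - 2a u₂ ∈ L²(ℝ)`. -/
theorem mem_domain_G (u : D.H) : u ∈ D.G.domain ↔
    ∃ u₂ : D.DS, DS.toL2 u₂ = u.snd ∧ ∃ h : L2, D.lap u.fst - (2 : ℂ) • D.damp u₂ = D.ofL2 h := by
  rw [LinearPMap.mem_domain_iff, graph_G]
  constructor
  · rintro ⟨v, u₂, h1, h2⟩
    exact ⟨u₂, h1, v.snd, congrArg Prod.snd h2⟩
  · rintro ⟨u₂, h1, h, h2⟩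
    exact ⟨WithLp.toLp 2 (D.embed u₂, h), u₂, h1, Prod.ext rfl h2⟩

end Coeff

/-- The point spectrum `σ_p(T)`: the set of eigenvalues of a (possibly unbounded) operator. -/
def pointSpectrum {E : Type*} [AddCommGroup E] [Module ℂ E] (T : E →ₗ.[ℂ] E) : Set ℂ :=
  {z | ∃ u : T.domain, (u : E) ≠ 0 ∧ T u = z • (u : E)}

/-- The standing assumption on the damping `a` and the potential `q`; here
`⟨x⟩ = (1 + x²)^{1/2}`. -/
structure Assumption (a q : ℝ → ℝ) : Prop where
  a_smooth : ContDiff ℝ ∞ a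
  q_smooth : ContDiff ℝ ∞ q
  a_nonneg : ∀ x, 0 ≤ a x
  q_nonneg : ∀ x, 0 ≤ q x
  a_unbounded : Tendsto a (cocompact ℝ) atTop
  a_symbol : ∀ n : ℕ, 1 ≤ n → ∃ C > 0, ∀ x,
    |iteratedDeriv n a x| ≤ C * (1 + a x) * (√(1 + x ^ 2) ^ n)⁻¹
  q_symbol : ∀ n : ℕ, 1 ≤ n → ∃ C > 0, ∀ x,
    |iteratedDeriv n q x| ≤ C * (1 + q x) * (√(1 + x ^ 2) ^ n)⁻¹
  q_le_a : ∃ x₀ > 0, ∃ K > 0, ∀ x, x₀ < |x| → q x ≤ K * a x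

/-- Coefficients satisfying the standing assumption are admissible for the definition of `G`. -/
def Assumption.coeff {a q : ℝ → ℝ} (h : Assumption a q) : Coeff where
  a := a
  q := q
  a_loc := h.a_smooth.continuous.locallyIntegrable
  q_loc := h.q_smooth.continuous.locallyIntegrable
  a_nonneg := Eventually.of_forall h.a_nonneg
  q_nonneg := Eventually.of_forall h.q_nonneg

end DampedWave

end

namespace DampedWave

open MeasureTheory Filter
open scoped InnerProductSpace ComplexConjugate

namespace Coeff

variable (D : Coeff)

/-! The proof is an energy balance. An eigenvector `(u₁, u₂)` for `z` satisfies `u₂ = z u₁` in `H₁`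
and `(∂ₓ² - q) u₁ - 2a u₂ = z u₂` in `D_S^*`. Since `u₂` lies in `D_S`, the second equation may be
tested against `u₂` itself. The first equation turns the term `((∂ₓ² - q) u₁, u₂)` into `-conj z
‖u₁‖²`, and taking real parts leaves `-2 ‖a^{1/2} u₂‖² = Re z (‖u₁‖² + ‖u₂‖²)`
(`dissipation_identity`).

If `Re z = 0`, the damping term must vanish, so `u₂ = 0` because `a ≠ 0` almost everywhere
(`eq_zero_of_sqrtA_eq_zero`). The second equation is then `(∂ₓ² - q) u₁ = 0`, and `lap_injective`
gives `u₁ = 0`. The argument never divides by `z`, so `z = 0` is not a separate case. -/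

theorem damp_apply (f g : D.DS) : D.damp f g = ⟪DS.sqrtA g, DS.sqrtA f⟫_ℂ :=
  D.dampForm_eq f g

/-- Together with `damp_apply`, this turns the pairings of the eigenvalue equation into `L²` inner
products, which become squared norms once the equation is tested against `u₂`. -/
theorem ofL2_apply (h : L2) (g : D.DS) : D.ofL2 h g = ⟪DS.toL2 g, h⟫_ℂ :=
  integral_mul_conj_eq_inner h (DS.toL2 g)

/-- `∂ₓ² - q` is injective on `H₁`, since test functions are dense there. -/
theorem lap_injective : Function.Injective D.lap := by
  rw [injective_iff_map_eq_zero]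
  intro w hw
  -- Orthogonality to `w` is a closed condition on `v`, so test functions suffice. For these, `f` is
  -- `embed (toDS f)`, and its inner product with `w` is `-lap w (toDS f)`, which vanishes.
  have key (v : D.H1) : ⟪v, w⟫_ℂ = 0 := by
    induction v using UniformSpace.Completion.induction_on with
    | hp => exact isClosed_eq (by fun_prop) continuous_const
    | ih f => rw [← embed_toDS, inner_embed, hw]; simp
  exact inner_self_eq_zero.mp (key w)

/-- `a^{1/2}` is injective on `D_S` if `a ≠ 0` almost everywhere. -/
theorem eq_zero_of_sqrtA_eq_zero (ha : ∀ᵐ x, D.a x ≠ 0) {u : D.DS} (hu : DS.sqrtA u = 0) :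
    u = 0 := by
  refine DS.toL2_injective ?_
  rw [map_zero, Lp.eq_zero_iff_ae_eq_zero]
  have h1 : (DS.sqrtA u : ℝ → ℂ) =ᵐ[volume] fun x => ((√(D.a x) : ℝ) : ℂ) * DS.toL2 u x :=
    coeFn_mulOp _ _
  rw [hu] at h1
  -- Nonnegativity of `a` matters here: `Real.sqrt` is zero on all negative numbers, so `√(a x) = 0`
  -- gives `a x = 0` only when `0 ≤ a x`.
  filter_upwards [h1, Lp.coeFn_zero ℂ 2 (volume : Measure ℝ), ha, D.a_nonneg] with x h1 h2 h3 h4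
  rw [h2, Pi.zero_apply, eq_comm, mul_eq_zero, Complex.ofReal_eq_zero,
    Real.sqrt_eq_zero h4] at h1
  exact h1.resolve_left h3

/-- The dissipation identity: testing the eigenvalue equation against `u₂`, the real part is
`-2 ‖a^{1/2} u₂‖² = Re z (‖u₁‖² + ‖u₂‖²)`. -/
theorem dissipation_identity {z : ℂ} {u₁ : D.H1} {u₂ : D.DS} (h₁ : D.embed u₂ = z • u₁)
    (h₂ : D.lap u₁ - (2 : ℂ) • D.damp u₂ = D.ofL2 (z • DS.toL2 u₂)) :
    -2 * ‖DS.sqrtA u₂‖ ^ 2 = z.re * (‖u₁‖ ^ 2 + ‖DS.toL2 u₂‖ ^ 2) := by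
  -- By `inner_embed` the pairing is `-⟪embed u₂, u₁⟫ = -⟪z u₁, u₁⟫`. The conjugate appears because
  -- the inner product is conjugate-linear in its first slot.
  have hlap : D.lap u₁ u₂ = -(conj z * (‖u₁‖ ^ 2 : ℝ)) := by
    have := D.inner_embed u₂ u₁
    rw [h₁, inner_smul_left, inner_self_eq_norm_sq_to_K] at this
    rw [← neg_eq_iff_eq_neg, ← this]
    push_cast
    rfl
  -- Since `conj z` and `z` have the same real part, the contributions of `‖u₁‖²` and `‖u₂‖²` add up
  -- with the common factor `z.re`.
  have h := congrArg (fun T : D.DSDual => (T u₂).re) h₂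
  simp only [sub_apply, smul_apply, damp_apply, ofL2_apply,
    inner_smul_right, inner_self_eq_norm_sq_to_K, hlap] at h
  simp [← Complex.ofReal_pow] at h
  linarith

/-- If `a ≠ 0` almost everywhere, then `G` has no eigenvalue on the imaginary axis. -/
theorem re_ne_zero_of_mem_pointSpectrum (ha : ∀ᵐ x, D.a x ≠ 0) {z : ℂ}
    (hz : z ∈ pointSpectrum D.G) : z.re ≠ 0 := by
  intro hre
  obtain ⟨u, hu0, hu⟩ := hz
  have hgraph := D.G.mem_graph u
  rw [graph_G, hu] at hgraph
  -- The second component of `u` is only an `L²` class; the graph provides its representative `u₂`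
  -- in `D_S`, where testing is allowed.
  obtain ⟨u₂, hu₂, hG⟩ := hgraph
  have h₁ : D.embed u₂ = z • (u : D.H).fst := congrArg Prod.fst hG
  have h₂ : D.lap (u : D.H).fst - (2 : ℂ) • D.damp u₂ = D.ofL2 (z • DS.toL2 u₂) := by
    rw [hu₂]; exact congrArg Prod.snd hG
  have hdiss := D.dissipation_identity h₁ h₂
  rw [hre, zero_mul] at hdiss
  have hu₂0 : u₂ = 0 := D.eq_zero_of_sqrtA_eq_zero ha (by simpa using hdiss)
  have hsnd : (u : D.H).snd = 0 := by rw [← hu₂, hu₂0]; simp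
  -- The first equation now reads `z u₁ = 0`, which says nothing when `z = 0`; the second reads `lap
  -- u₁ = 0` and settles every case.
  have hfst : (u : D.H).fst = 0 := by
    refine D.lap_injective (ContinuousLinearMap.ext fun g => ?_)
    have hg := congrArg (fun T : D.DSDual => T g) h₂
    simpa [hu₂0] using hg
  exact hu0 (WithLp.ofLp_injective 2 (Prod.ext hfst hsnd))

end Coeff

end DampedWave

theorem mainTheorem6 (a q : ℝ → ℝ) (h : DampedWave.Assumption a q)
    (ha : ∀ᵐ x ∂(MeasureTheory.volume : MeasureTheory.Measure ℝ), a x ≠ 0) :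
    DampedWave.pointSpectrum h.coeff.G ∩ {z : ℂ | z.re = 0} = ∅ :=
  Set.eq_empty_iff_forall_notMem.mpr fun _ hz =>
    h.coeff.re_ne_zero_of_mem_pointSpectrum ha hz.1 hz.2
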